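/- Let $\mathcal G=(\mathcal V,\mathcal E)$ be a finite connected undirected simple graph, $k,N\in\mathbb N$. For $i\in\mathcal V$ let $\mathcal N_i$ be its set of neighbours, let $\mathcal N_i^{k\text{-hop}}=\{j\in\mathcal V: 2\le \operatorname{dist}(i,j)\le k\}$ with $\eta_i=|\mathcal N_i^{k\text{-hop}}|$, let $P_i$ and $\hat P_i$ be the matrices that select from a vector stacked over all agents (with blocks in $\mathbb R^N$) the blocks of the agents in $\mathcal N_i$ and in $\mathcal N_i^{k\text{-hop}}$ respectively, and put $M_i^{kc}=L_i^{kc}+H_i^{kc}$, where $L_i^{kc}$ is the Laplacian of the subgraph of $\mathcal G$ induced by $\mathcal N_i^{k\text{-hop}}$ and $H_i^{kc}=\operatorname{diag}(|\mathcal N_l\cap\mathcal N_i|)_{l\in\mathcal N_i^{k\text{-hop}}}$. For a function $f$ between Euclidean spaces let $K[f](y)=\bigcap_{\delta>0}\bigcap_{\mu(M)=0}\overline{\mathrm{co}}\,f(\mathcal B(y,\delta)\setminus M)$, where $\mu$ is Lebesgue measure, and let $\|K[f]\|$ be the supremum of $\|z\|$ over all $z\in K[f](y)$ and all $y$ in the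 domain under consideration. A Filippov solution of $\dot y=F(t,y)$ on $[0,\infty)$ is a locally absolutely continuous $y$ with $\dot y(t)\in K[F(t,\cdot)](y(t))$ for almost every $t>0$. Let agent $j$ have the input $u_j:[0,\infty)\to\mathbb R^N$, and let $\mathbf u$ be the stack of all inputs. Each agent $i$ keeps the vector $\hat{\mathbf u}^i$ of its estimates $\hat u^i_j\in\mathbb R^N$ of the inputs $u_j$, $j\in\mathcal N_i^{k\text{-hop}}$, and runs the observer $$\dot{\hat{\mathbf u}}^i=(\Pi^i\otimes I_N)\,\mathrm{sign}(\rho^i),\qquad \Pi^i=\operatorname{diag}(\pi_j)_{j\in\mathcal N_i^{k\text{-hop}}},$$ $$\rho^i=\sum_{j\in\mathcal N_i}\Big[\hat P_i\big(-\hat P_j^\top\hat P_j\hat P_i^\top\hat{\mathbf u}^i+\hat P_i^\top\hat P_i\hat P_j^\top\hat{\mathbf u}^j\big)+\hat P_i\big(-P_j^\top P_j\hat P_i^\top\hat{\mathbf u}^i+\hat P_i^\top\hat P_i P_j^\top P_j\mathbf u\big)\Big],$$ where $\pi_j\in\mathbb R$ are gains and $\mathrm{sign}$ acts entrywise, with $\mathrm{sign}(x)=1$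 for $x\ge0$ and $-1$ for $x<0$. Let $(\hat{\mathbf u}^l)_{l\in\mathcal V}$ be a Filippov solution on $[0,\infty)$ of these equations, and let $\tilde{\mathbf u}_i=(u_i-\hat u_i^l)_{l\in\mathcal N_i^{k\text{-hop}}}$ be the stacked errors on the input of agent $i$. Let $i\in\mathcal V$ with $\mathcal N_i^{k\text{-hop}}\ne\emptyset$. Assume that $u_i$ is locally absolutely continuous, that $\|K[\dot u_i]\|\le d_{\dot u_i}$ for some $d_{\dot u_i}\ge0$, where $K[\dot u_i]$ is the set-valued map of the time function $\dot u_i$ on $(0,\infty)$, and that $$\pi_i>\frac{\lambda_{\max}(M_i^{kc})}{\lambda_{\min}(M_i^{kc})}\sqrt{\eta_i}\,d_{\dot u_i}.$$ Then $\lambda_{\min}(M_i^{kc})>0$, $$\psi_i:=\pi_i\lambda_{\min}(M_i^{kc})-\|M_i^{kc}\otimes I_N\|\sqrt{\eta_i}\,d_{\dot u_i}>0,$$ and $\tilde{\mathbf u}_i$ reaches zero in finite time and stays there: there is a least time $T_{u,i}\ge0$ such that $\tilde{\mathbf u}_i(t)=0$ for all $t\ge T_{u,i}$. Moreover $T_{u,i}>0$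 if $\tilde{\mathbf u}_i(0)\neq0$, and $$T_{u,i}\le\frac{\lambda_{\max}(M_i^{kc})}{\psi_i}\,\|\tilde{\mathbf u}_i(0)\|.$$ -/

import Mathlib

open MeasureTheory Set
open scoped Kronecker NNReal ENNReal Matrix

noncomputable section

namespace KHopObserver

/-! ### Filippov set-valued maps and solutions -/

/-- The Filippov set-valued map: `K[f](y)` is the intersection, over all `δ > 0` and all Lebesgue
null sets `M`, of the closed convex hulls of `f (B(y, δ) \ M)`. -/
def filippovMap {E F : Type*} [NormedAddCommGroup E] [MeasureSpace E]
    [NormedAddCommGroup F] [NormedSpace ℝ F] (f : E → F) (y : E) : Set F :=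
  ⋂ (δ : ℝ) (_ : 0 < δ) (M : Set E) (_ : volume M = 0),
    closedConvexHull ℝ (f '' (Metric.ball y δ \ M))

/-- `‖K[f]‖` is the supremum of `‖z‖` over all `z` in the range of `K[f]`; here `f` is considered
on the domain `S`. -/
def filippovNormOn {E F : Type*} [NormedAddCommGroup E] [MeasureSpace E]
    [NormedAddCommGroup F] [NormedSpace ℝ F] (S : Set E) (f : E → F) : ℝ≥0∞ :=
  ⨆ y ∈ S, ⨆ z ∈ filippovMap f y, ‖z‖ₑ

/-- `f` is absolutely continuous on every compact subinterval of `[0, ∞)`. -/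
def LocallyAC {F : Type*} [NormedAddCommGroup F] (f : ℝ → F) : Prop :=
  ∀ T : ℝ, 0 < T → AbsolutelyContinuousOnInterval f 0 T

/-- `y` is a Filippov solution on `[0, ∞)` of `y' = F(t, y)`: it is locally absolutely continuous
and `y'(t) ∈ K[F(t, ·)](y(t))` for almost every `t > 0`. -/
def IsFilippovSolution {E : Type*} [NormedAddCommGroup E] [NormedSpace ℝ E] [MeasureSpace E]
    (F : ℝ → E → E) (y : ℝ → E) : Prop :=
  LocallyAC y ∧
    ∀ᵐ t ∂(volume.restrict (Ioi (0 : ℝ))), ∃ v ∈ filippovMap (F t) (y t), HasDerivAt y v t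

/-- The sign function, with `sign 0 = 1`. -/
def sgn (x : ℝ) : ℝ := if 0 ≤ x then 1 else -1

/-! ### Extreme eigenvalues -/

/-- The largest (real) eigenvalue. -/
def lambdaMax {n : Type*} [Fintype n] [DecidableEq n] (B : Matrix n n ℝ) : ℝ :=
  sSup (spectrum ℝ B)

/-- The smallest (real) eigenvalue. -/
def lambdaMin {n : Type*} [Fintype n] [DecidableEq n] (B : Matrix n n ℝ) : ℝ :=
  sInf (spectrum ℝ B)

/-- The spectral norm (operator norm for the Euclidean norm). -/
def specNorm {n : Type*} [Fintype n] [DecidableEq n] (B : Matrix n n ℝ) : ℝ :=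
  ‖Matrix.toEuclideanCLM (n := n) (𝕜 := ℝ) B‖

/-! ### The `k`-hop neighbours and the matrix `M` -/

variable {V : Type*}

/-- The agents whose graph distance from `i` is at least `2` and at most `k`. -/
def khop (G : SimpleGraph V) (k : ℕ) (i : V) : Set V :=
  {j | 2 ≤ G.dist i j ∧ G.dist i j ≤ k}

instance (G : SimpleGraph V) (k : ℕ) (i : V) : DecidablePred (· ∈ khop G k i) :=
  fun j => inferInstanceAs (Decidable (2 ≤ G.dist i j ∧ G.dist i j ≤ k))

/-- `η i`, the number of `k`-hop neighbours of `i`. -/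
def eta [Fintype V] (G : SimpleGraph V) (k : ℕ) (i : V) : ℕ := Fintype.card (khop G k i)

/-- `i` is a `k`-hop neighbour of each of its `k`-hop neighbours. -/
theorem khop_symm {G : SimpleGraph V} {k : ℕ} {i l : V} (h : l ∈ khop G k i) :
    i ∈ khop G k l := by
  have h' : 2 ≤ G.dist i l ∧ G.dist i l ≤ k := h
  rw [SimpleGraph.dist_comm] at h'
  exact h'

variable [Fintype V] [DecidableEq V]

/-- `M = L + H`: `L` is the Laplacian of the subgraph induced by the `k`-hop neighbours of `i`, and
`H` is diagonal with entries `|N_l ∩ N_i|`. -/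
def Mkc (G : SimpleGraph V) [DecidableRel G.Adj] (k : ℕ) (i : V) :
    Matrix (khop G k i) (khop G k i) ℝ :=
  (G.induce (khop G k i)).lapMatrix ℝ +
    Matrix.diagonal fun l : khop G k i => ((G.neighborFinset l ∩ G.neighborFinset i).card : ℝ)

/-! ### The input observer -/

/-- The matrix selecting from a vector stacked over all agents the blocks, each of size `N`, that
belong to the agents in `S`. -/
def selection (N : ℕ) (S : Set V) : Matrix (S × Fin N) (V × Fin N) ℝ :=
  (Matrix.of fun (a : S) (b : V) => if (a : V) = b then (1 : ℝ) else 0) ⊗ₖ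
    (1 : Matrix (Fin N) (Fin N) ℝ)

/-- Selection of the `k`-hop neighbours of `i`. -/
def hatP (G : SimpleGraph V) (k N : ℕ) (i : V) : Matrix (khop G k i × Fin N) (V × Fin N) ℝ :=
  selection N (khop G k i)

/-- Selection of the neighbours of `i`. -/
def nbrP (G : SimpleGraph V) (N : ℕ) (i : V) :
    Matrix (G.neighborSet i × Fin N) (V × Fin N) ℝ :=
  selection N (G.neighborSet i)

/-- The estimates of all agents, stacked: the entry `⟨l, (j, a)⟩` is the `a`-th coordinate of the
estimate, by agent `l`, of the input of its `k`-hop neighbour `j`. -/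
abbrev Estimates (G : SimpleGraph V) (k N : ℕ) : Type _ :=
  EuclideanSpace ℝ ((l : V) × (khop G k l × Fin N))

/-- The stacked estimates made by agent `l`. -/
def estimatesOf {G : SimpleGraph V} {k N : ℕ} (z : Estimates G k N) (l : V) :
    khop G k l × Fin N → ℝ :=
  fun p => z ⟨l, p⟩

/-- The stacked input vector of all agents. -/
def stack {N : ℕ} (w : V → EuclideanSpace ℝ (Fin N)) : V × Fin N → ℝ :=
  fun p => w p.1 p.2

/-- The disagreement vector `ρ` of agent `i`, for the estimates `z` and the true inputs `w`. -/
def rho (G : SimpleGraph V) [DecidableRel G.Adj] {k N : ℕ} (z : Estimates G k N)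
    (w : V → EuclideanSpace ℝ (Fin N)) (i : V) : khop G k i × Fin N → ℝ :=
  ∑ j ∈ G.neighborFinset i,
    (hatP G k N i *ᵥ
        (-((hatP G k N j)ᵀ *ᵥ (hatP G k N j *ᵥ ((hatP G k N i)ᵀ *ᵥ estimatesOf z i))) +
          (hatP G k N i)ᵀ *ᵥ (hatP G k N i *ᵥ ((hatP G k N j)ᵀ *ᵥ estimatesOf z j))) +
      hatP G k N i *ᵥ
        (-((nbrP G N j)ᵀ *ᵥ (nbrP G N j *ᵥ ((hatP G k N i)ᵀ *ᵥ estimatesOf z i))) +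
          (hatP G k N i)ᵀ *ᵥ (hatP G k N i *ᵥ ((nbrP G N j)ᵀ *ᵥ (nbrP G N j *ᵥ stack w)))))

/-- The gain matrix `Π ⊗ I_N` of agent `i`, with `Π` diagonal and with the entry `gain j` at the
`k`-hop neighbour `j`. -/
def gainMatrix (G : SimpleGraph V) (k N : ℕ) (gain : V → ℝ) (i : V) :
    Matrix (khop G k i × Fin N) (khop G k i × Fin N) ℝ :=
  (Matrix.diagonal fun j : khop G k i => gain j) ⊗ₖ (1 : Matrix (Fin N) (Fin N) ℝ)

/-- The right-hand side of the observer run by all agents: the block of agent `i` is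
`(Π ⊗ I_N) sign(ρ)`, the sign being taken entrywise. -/
def observerField (G : SimpleGraph V) [DecidableRel G.Adj] (k N : ℕ) (gain : V → ℝ)
    (u : V → ℝ → EuclideanSpace ℝ (Fin N)) (t : ℝ) (z : Estimates G k N) : Estimates G k N :=
  WithLp.toLp 2 fun q =>
    (gainMatrix G k N gain q.1 *ᵥ fun p => sgn (rho G z (fun j => u j t) q.1 p)) q.2

/-- The error on the input of agent `i`: the entry `(l, a)` is the `a`-th coordinate of the
difference between `u i` and its estimate made by the `k`-hop neighbour `l` of `i`. -/
def inputError {G : SimpleGraph V} {k N : ℕ} (u : V → ℝ → EuclideanSpace ℝ (Fin N))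
    (z : ℝ → Estimates G k N) (i : V) (t : ℝ) : EuclideanSpace ℝ (khop G k i × Fin N) :=
  WithLp.toLp 2 fun p => u i t p.2 - z t ⟨p.1, (⟨i, khop_symm p.1.2⟩, p.2)⟩

/-- The constant `ψ` of agent `i`, for a bound `d` on the derivative of its input. -/
def psi (G : SimpleGraph V) [DecidableRel G.Adj] (k N : ℕ) (gain : V → ℝ) (i : V) (d : ℝ) : ℝ :=
  gain i * lambdaMin (Mkc G k i) -
    specNorm (Mkc G k i ⊗ₖ (1 : Matrix (Fin N) (Fin N) ℝ)) * √(eta G k i : ℝ) * d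

end KHopObserver

end

/-! Fix `i` and let `e` be the stacked error on its input. The block of `rho` that drives the
estimates of `u i` is exactly `(M ⊗ I) e` (`rho_apply`), so the observer decouples into one
sign-driven system per input: `e' = 1 ⊗ u_i' - v`, with `v` a Filippov selection of `π_i sign((M ⊗
I) e)`. Off the discontinuity the sign is locally constant, so each coordinate of `v` pairs with `(M
⊗ I) e` to `π_i` times an absolute value; on the discontinuity both sides vanish. Hence `⟨(M ⊗ I) e,
e'⟩ ≤ -ψ ‖e‖` (`inner_disagreement_le`). Factor `M ⊗ I = B† B`. The Lyapunov function `W = ‖B e‖`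
satisfies `W ≤ √λmax ‖e‖`, so `W' ≤ -ψ / √λmax` wherever `W > 0`, and `W` reaches zero in finite
time. This needs `M` positive definite, which follows from connectedness (`posDef_Mkc`). -/

namespace KHopObserver

/-! ### Filippov set-valued maps. -/

section Filippov

variable {E F : Type*} [NormedAddCommGroup E] [MeasureSpace E]
  [NormedAddCommGroup F] [NormedSpace ℝ F]

/-- Almost every value of a function lies in its Filippov set-valued map. -/
theorem ae_mem_filippovMap [SecondCountableTopology E] [SecondCountableTopology F] (f : E → F) :
    ∀ᵐ x, f x ∈ filippovMap f x := by
  let B := TopologicalSpace.countableBasis F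
  have hB : TopologicalSpace.IsTopologicalBasis B := TopologicalSpace.isBasis_countableBasis F
  -- For fixed `b`, the points of `f ⁻¹' b` near which `f ⁻¹' b` is null form a locally null set,
  -- hence a null set. No measurability of `f` is needed.
  have hnull : ∀ b ∈ B, ∀ᵐ x : E,
      ¬ (f x ∈ b ∧ ∃ δ > 0, volume (Metric.ball x δ ∩ f ⁻¹' b) = 0) := by
    intro b _
    rw [ae_iff]
    simp only [not_not]
    refine measure_null_of_locally_null _ fun x hx => ?_
    obtain ⟨-, δ, hδ, h0⟩ := hx
    refine ⟨_, inter_mem_nhdsWithin _ (Metric.ball_mem_nhds x hδ), measure_mono_null ?_ h0⟩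
    rintro y ⟨⟨hy, -⟩, hyb⟩
    exact ⟨hyb, hy⟩
  filter_upwards [(ae_ball_iff (TopologicalSpace.countable_countableBasis F)).2 hnull] with x hx
  simp only [filippovMap, mem_iInter]
  intro δ hδ M hM
  -- Convexity plays no role: `f x` already lies in the closure of the image.
  refine closure_minimal subset_closedConvexHull isClosed_closedConvexHull ?_
  rw [hB.mem_closure_iff]
  intro b hb hxb
  by_contra hne
  refine hx b hb ⟨hxb, δ, hδ, measure_mono_null (fun y hy => ?_) hM⟩
  by_contra hyM
  exact hne ⟨f y, hy.2, y, ⟨hy.1, hyM⟩, rfl⟩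

/-- A closed convex set containing all nearby values contains the Filippov set. -/
theorem filippovMap_subset_of_eventually {f : E → F} {y : E} {C : Set F} (hC : Convex ℝ C)
    (hC' : IsClosed C) (h : ∀ᶠ x in nhds y, f x ∈ C) : filippovMap f y ⊆ C := by
  obtain ⟨δ, hδ, hball⟩ := Metric.eventually_nhds_iff_ball.1 h
  intro v hv
  simp only [filippovMap, mem_iInter] at hv
  refine closedConvexHull_min ?_ hC hC' (hv δ hδ ∅ measure_empty)
  rintro _ ⟨x, hx, rfl⟩
  exact hball x hx.1

/-- A bound on the Filippov norm bounds almost all values of the function. -/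
theorem ae_norm_le_of_filippovNormOn_le [SecondCountableTopology E] [SecondCountableTopology F]
    {f : E → F} {S : Set E} (hS : MeasurableSet S) {d : ℝ≥0} (h : filippovNormOn S f ≤ d) :
    ∀ᵐ x ∂(volume.restrict S), ‖f x‖ ≤ d := by
  rw [ae_restrict_iff' hS]
  filter_upwards [ae_mem_filippovMap f] with x hx hxS
  have : ‖f x‖ₑ ≤ d :=
    (le_iSup₂_of_le x hxS (le_iSup₂ (f := fun z (_ : z ∈ filippovMap f x) => ‖z‖ₑ) _ hx)).trans h
  rw [← ofReal_norm, ENNReal.ofReal_le_iff_le_toReal ENNReal.coe_ne_top] at this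
  simpa using this

end Filippov

/-! ### Locally absolutely continuous functions and finite-time extinction. -/

section AbsoluteContinuity

theorem _root_.LipschitzWith.comp_absolutelyContinuousOnInterval {X Y : Type*}
    [PseudoMetricSpace X] [PseudoMetricSpace Y] {K : ℝ≥0} {g : X → Y} (hg : LipschitzWith K g)
    {f : ℝ → X} {a b : ℝ} (hf : AbsolutelyContinuousOnInterval f a b) :
    AbsolutelyContinuousOnInterval (g ∘ f) a b := by
  apply squeeze_zero (fun t => ?_) (fun t => ?_)
    (by simpa using Filter.Tendsto.const_mul (K : ℝ) hf)
  · exact Finset.sum_nonneg fun i _ => dist_nonneg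
  · rw [Finset.mul_sum]
    exact Finset.sum_le_sum fun i _ => hg.dist_le_mul _ _

theorem LocallyAC.lipschitz_comp {X Y : Type*} [NormedAddCommGroup X] [NormedAddCommGroup Y]
    {K : ℝ≥0} {g : X → Y} (hg : LipschitzWith K g) {f : ℝ → X} (hf : LocallyAC f) :
    LocallyAC (g ∘ f) :=
  fun T hT => hg.comp_absolutelyContinuousOnInterval (hf T hT)

theorem LocallyAC.clm_comp {X Y : Type*} [NormedAddCommGroup X] [NormedAddCommGroup Y]
    [NormedSpace ℝ X] [NormedSpace ℝ Y] (g : X →L[ℝ] Y) {f : ℝ → X} (hf : LocallyAC f) :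
    LocallyAC fun t => g (f t) :=
  hf.lipschitz_comp g.lipschitz

theorem LocallyAC.sub {X : Type*} [NormedAddCommGroup X] {f g : ℝ → X}
    (hf : LocallyAC f) (hg : LocallyAC g) : LocallyAC (fun t => f t - g t) :=
  fun T hT => (hf T hT).sub (hg T hT)

theorem LocallyAC.continuousOn {X : Type*} [NormedAddCommGroup X] {f : ℝ → X}
    (hf : LocallyAC f) : ContinuousOn f (Ici 0) := by
  intro t ht
  have h : 0 < t + 1 := by have := mem_Ici.1 ht; linarith
  have := (hf (t + 1) h).continuousOn
  rw [uIcc_of_le h.le] at this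
  refine (this t ⟨ht, by linarith⟩).mono_of_mem_nhdsWithin ?_
  exact Filter.mem_of_superset (inter_mem_nhdsWithin _ (Iio_mem_nhds (lt_add_one t)))
    fun s hs => ⟨hs.1, le_of_lt hs.2⟩

theorem LocallyAC.ae_differentiableAt {X : Type*} [NormedAddCommGroup X] [NormedSpace ℝ X]
    [FiniteDimensional ℝ X] {f : ℝ → X} (hf : LocallyAC f) :
    ∀ᵐ t ∂(volume.restrict (Ioi (0 : ℝ))), DifferentiableAt ℝ f t := by
  rw [ae_restrict_iff' measurableSet_Ioi]
  have : ∀ n : ℕ, ∀ᵐ t : ℝ, t ∈ uIcc (0 : ℝ) (n + 1 : ℝ) → DifferentiableAt ℝ f t :=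
    fun n => (hf (n + 1) (by positivity)).boundedVariationOn.ae_differentiableAt_of_mem_uIcc
  filter_upwards [ae_all_iff.2 this] with t ht ht0
  obtain ⟨n, hn⟩ := exists_nat_ge t
  refine ht n ?_
  rw [uIcc_of_le (by positivity)]
  exact ⟨le_of_lt ht0, by linarith⟩

theorem LocallyAC.sub_le_of_ae_deriv_le {W : ℝ → ℝ} (hW : LocallyAC W) {a b K : ℝ} (ha : 0 ≤ a)
    (hab : a ≤ b)
    (h : ∀ᵐ t ∂(volume.restrict (Ioi (0 : ℝ))), t ∈ Icc a b → deriv W t ≤ K) :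
    W b - W a ≤ K * (b - a) := by
  rcases hab.eq_or_lt with rfl | hlt
  · simp
  have hb : 0 < b := ha.trans_lt hlt
  have hac : AbsolutelyContinuousOnInterval W a b := by
    refine (hW b hb).mono ?_
    rw [uIcc_of_le hab, uIcc_of_le hb.le]
    exact Icc_subset_Icc_left ha
  rw [← hac.integral_deriv_eq_sub]
  calc ∫ t in a..b, deriv W t ≤ ∫ _ in a..b, K := by
        refine intervalIntegral.integral_mono_ae_restrict hab hac.intervalIntegrable_deriv
          intervalIntegrable_const ?_
        rw [ae_restrict_iff' measurableSet_Ioi] at h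
        rw [Filter.EventuallyLE, ae_restrict_iff' measurableSet_Icc]
        -- The hypothesis concerns `t > 0` only, while `a` may be `0`; that point is null.
        filter_upwards [h, Measure.ae_ne volume (0 : ℝ)] with t ht ht0 hmem
        exact ht (lt_of_le_of_ne (ha.trans hmem.1) (Ne.symm ht0)) hmem
    _ = K * (b - a) := by simp [mul_comm]

variable {W : ℝ → ℝ} {c : ℝ}

/-- A nonnegative function that decreases wherever it is positive is antitone. -/
theorem LocallyAC.antitoneOn_of_ae_deriv_neg (hW : LocallyAC W) (hnn : ∀ t, 0 ≤ W t) (hc : 0 < c)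
    (hd : ∀ᵐ t ∂(volume.restrict (Ioi (0 : ℝ))), 0 < W t → deriv W t ≤ -c) :
    AntitoneOn W (Ici 0) := by
  intro a ha b _ hab
  have := hW.sub_le_of_ae_deriv_le (K := 0) ha hab (by
    filter_upwards [hd] with t ht _
    rcases (hnn t).eq_or_lt with h0 | h0
    -- A zero of `W` is a global minimum, so `deriv W` vanishes there, by its default value if `W`
    -- is not differentiable.
    · exact (IsLocalMin.deriv_eq_zero (Filter.Eventually.of_forall fun s => h0 ▸ hnn s)).le
    · exact (ht h0).trans (by linarith))
  linarith

/-- A nonnegative function that decreases at rate at least `c` wherever it is positive vanishes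
from the time `W 0 / c` on. -/
theorem LocallyAC.eq_zero_of_ae_deriv_neg (hW : LocallyAC W) (hnn : ∀ t, 0 ≤ W t) (hc : 0 < c)
    (hd : ∀ᵐ t ∂(volume.restrict (Ioi (0 : ℝ))), 0 < W t → deriv W t ≤ -c)
    {t : ℝ} (ht : W 0 / c ≤ t) : W t = 0 := by
  have ht0 : 0 ≤ t := (div_nonneg (hnn 0) hc.le).trans ht
  by_contra hne
  have hpos : 0 < W t := lt_of_le_of_ne (hnn t) (Ne.symm hne)
  have hanti := hW.antitoneOn_of_ae_deriv_neg hnn hc hd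
  -- By monotonicity `W t > 0` keeps `W` positive on all of `[0, t]`, so the rate `-c` holds
  -- throughout.
  have := hW.sub_le_of_ae_deriv_le (K := -c) le_rfl ht0 (by
    filter_upwards [hd] with s hs hmem
    exact hs (hpos.trans_le (hanti hmem.1 ht0 hmem.2)))
  rw [div_le_iff₀ hc] at ht
  linarith

end AbsoluteContinuity

/-! ### Extreme eigenvalues and quadratic forms. -/

section Spectrum

variable {n : Type*} [Fintype n] [DecidableEq n] {A : Matrix n n ℝ}

/-- A finite nonempty spectrum attains its infimum; for an empty index type `sInf ∅ = 0` and the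
claim fails. -/
theorem lambdaMin_pos [Nonempty n] (hA : A.PosDef) : 0 < lambdaMin A := by
  have hs := hA.isHermitian.spectrum_real_eq_range_eigenvalues
  have hmem : lambdaMin A ∈ spectrum ℝ A := by
    unfold lambdaMin
    rw [hs]
    exact (range_nonempty _).csInf_mem (finite_range _)
  rw [hs] at hmem
  obtain ⟨j, hj⟩ := hmem
  exact hj ▸ hA.eigenvalues_pos j

theorem lambdaMin_le_lambdaMax [Nonempty n] (hA : A.IsHermitian) : lambdaMin A ≤ lambdaMax A := by
  unfold lambdaMin lambdaMax
  rw [hA.spectrum_real_eq_range_eigenvalues]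
  exact csInf_le_csSup (range_nonempty _) (finite_range _).bddBelow (finite_range _).bddAbove

-- The Rayleigh bound is the Loewner inequality `lambdaMin A • 1 ≤ A`, which is equivalent to a
-- lower bound on the spectrum.
open scoped MatrixOrder in
theorem lambdaMin_mul_le (hA : A.IsHermitian) (x : n → ℝ) :
    lambdaMin A * (x ⬝ᵥ x) ≤ x ⬝ᵥ (A *ᵥ x) := by
  have hle : algebraMap ℝ _ (lambdaMin A) ≤ A := by
    rw [algebraMap_le_iff_le_spectrum (a := A) hA]
    intro y hy
    refine csInf_le ?_ hy
    rw [hA.spectrum_real_eq_range_eigenvalues]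
    exact (finite_range _).bddBelow
  have := (Matrix.le_iff.1 hle).dotProduct_mulVec_nonneg x
  simpa [Matrix.sub_mulVec, Algebra.algebraMap_eq_smul_one, Matrix.smul_mulVec, dotProduct_sub]
    using this

open scoped MatrixOrder in
theorem le_lambdaMax_mul (hA : A.IsHermitian) (x : n → ℝ) :
    x ⬝ᵥ (A *ᵥ x) ≤ lambdaMax A * (x ⬝ᵥ x) := by
  have hle : A ≤ algebraMap ℝ _ (lambdaMax A) := by
    rw [le_algebraMap_iff_spectrum_le (a := A) hA]
    intro y hy
    refine le_csSup ?_ hy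
    rw [hA.spectrum_real_eq_range_eigenvalues]
    exact (finite_range _).bddAbove
  have := (Matrix.le_iff.1 hle).dotProduct_mulVec_nonneg x
  simpa [Matrix.sub_mulVec, Algebra.algebraMap_eq_smul_one, Matrix.smul_mulVec, dotProduct_sub]
    using this

end Spectrum

/-! ### Quadratic forms of `A ⊗ I`. -/

section Kronecker

variable {n m : Type*} [Fintype n] [DecidableEq n] [Fintype m] [DecidableEq m] {A : Matrix n n ℝ}

omit [DecidableEq n] in
theorem kronecker_one_mulVec (A : Matrix n n ℝ) (x : n × m → ℝ) (p : n × m) :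
    ((A ⊗ₖ (1 : Matrix m m ℝ)) *ᵥ x) p = (A *ᵥ fun l => x (l, p.2)) p.1 := by
  simp [Matrix.mulVec, dotProduct, Fintype.sum_prod_type, Matrix.one_apply]

-- Since `A ⊗ I` acts separately on each slice, bounds on the form of `A` transfer by summation,
-- without the spectrum of the product.
omit [DecidableEq n] in
theorem dotProduct_kronecker_one_mulVec (A : Matrix n n ℝ) (x y : n × m → ℝ) :
    y ⬝ᵥ ((A ⊗ₖ (1 : Matrix m m ℝ)) *ᵥ x) =
      ∑ a : m, (fun l => y (l, a)) ⬝ᵥ (A *ᵥ fun l => x (l, a)) := by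
  simp only [dotProduct, kronecker_one_mulVec, Fintype.sum_prod_type_right]

theorem lambdaMin_mul_le_kronecker (hA : A.IsHermitian) (x : n × m → ℝ) :
    lambdaMin A * (x ⬝ᵥ x) ≤ x ⬝ᵥ ((A ⊗ₖ (1 : Matrix m m ℝ)) *ᵥ x) := by
  have hx : x ⬝ᵥ x = ∑ a : m, (fun l => x (l, a)) ⬝ᵥ (fun l => x (l, a)) := by
    simp only [dotProduct, Fintype.sum_prod_type_right]
  rw [dotProduct_kronecker_one_mulVec, hx, Finset.mul_sum]
  exact Finset.sum_le_sum fun a _ => lambdaMin_mul_le hA _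

theorem kronecker_le_lambdaMax_mul (hA : A.IsHermitian) (x : n × m → ℝ) :
    x ⬝ᵥ ((A ⊗ₖ (1 : Matrix m m ℝ)) *ᵥ x) ≤ lambdaMax A * (x ⬝ᵥ x) := by
  have hx : x ⬝ᵥ x = ∑ a : m, (fun l => x (l, a)) ⬝ᵥ (fun l => x (l, a)) := by
    simp only [dotProduct, Fintype.sum_prod_type_right]
  rw [dotProduct_kronecker_one_mulVec, hx, Finset.mul_sum]
  exact Finset.sum_le_sum fun a _ => le_lambdaMax_mul hA _

end Kronecker

/-! ### Factorization `Q = B† B` and the spectral norm. -/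

section Factorization

variable {n : Type*} [Fintype n] [DecidableEq n]

open scoped MatrixOrder in
/-- A positive semidefinite matrix, as an operator, is `B† B`. -/
theorem exists_adjoint_comp_self {Q : Matrix n n ℝ} (hQ : Q.PosSemidef) :
    ∃ B : EuclideanSpace ℝ n →L[ℝ] EuclideanSpace ℝ n,
      ContinuousLinearMap.adjoint B ∘L B = Matrix.toEuclideanCLM (n := n) (𝕜 := ℝ) Q := by
  obtain ⟨B, rfl⟩ := CStarAlgebra.nonneg_iff_eq_star_mul_self.1 hQ.nonneg
  refine ⟨Matrix.toEuclideanCLM (n := n) (𝕜 := ℝ) B, ?_⟩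
  rw [map_mul, map_star]
  rfl

theorem inner_toEuclideanCLM (Q : Matrix n n ℝ) (x y : EuclideanSpace ℝ n) :
    inner ℝ y (Matrix.toEuclideanCLM (n := n) (𝕜 := ℝ) Q x) = y.ofLp ⬝ᵥ (Q *ᵥ x.ofLp) := by
  rw [EuclideanSpace.inner_eq_star_dotProduct, dotProduct_comm]
  simp

omit [DecidableEq n] in
theorem dotProduct_self_eq_norm_sq (x : EuclideanSpace ℝ n) : x.ofLp ⬝ᵥ x.ofLp = ‖x‖ ^ 2 := by
  rw [EuclideanSpace.real_norm_sq_eq]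
  simp [dotProduct, sq]

/-- With `Q = B† B`, the C*-identity gives `‖Q‖ = ‖B‖ ^ 2`, and `‖B x‖ ^ 2` is the quadratic form of
`Q`. -/
theorem specNorm_le_of_dotProduct_le {Q : Matrix n n ℝ} (hQ : Q.PosSemidef) {r : ℝ} (hr : 0 ≤ r)
    (h : ∀ x : n → ℝ, x ⬝ᵥ (Q *ᵥ x) ≤ r * (x ⬝ᵥ x)) : specNorm Q ≤ r := by
  obtain ⟨B, hB⟩ := exists_adjoint_comp_self hQ
  rw [specNorm, ← hB, ContinuousLinearMap.norm_adjoint_comp_self, ← sq]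
  rw [← Real.le_sqrt (norm_nonneg _) hr]
  refine B.opNorm_le_bound (Real.sqrt_nonneg _) fun x => ?_
  rw [← Real.sqrt_sq (norm_nonneg x), ← Real.sqrt_mul hr]
  refine Real.le_sqrt_of_sq_le ?_
  have h1 := h x.ofLp
  rw [← inner_toEuclideanCLM, ← hB, dotProduct_self_eq_norm_sq] at h1
  rwa [ContinuousLinearMap.comp_apply, ContinuousLinearMap.adjoint_inner_right,
    real_inner_self_eq_norm_sq] at h1

/-- Equality fails for empty `m`, where the norm is `0`; positivity of `psi` needs only this
direction. -/
theorem specNorm_kronecker_le {m : Type*} [Fintype m] [DecidableEq m] [Nonempty n]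
    {A : Matrix n n ℝ} (hA : A.PosDef) :
    specNorm (A ⊗ₖ (1 : Matrix m m ℝ)) ≤ lambdaMax A :=
  specNorm_le_of_dotProduct_le (hA.posSemidef.kronecker Matrix.PosSemidef.one)
    ((lambdaMin_pos hA).le.trans (lambdaMin_le_lambdaMax hA.isHermitian))
    (kronecker_le_lambdaMax_mul hA.isHermitian)

end Factorization

/-! ### Positive definiteness of `M` from connectedness. -/

section Graph

variable {V : Type*}

/-- A vertex at distance `n + 1` has a neighbour at distance `n`. -/
theorem exists_adj_dist_eq {G : SimpleGraph V} (hG : G.Connected) {i l : V} {n : ℕ}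
    (h : G.dist i l = n + 1) : ∃ j, G.Adj l j ∧ G.dist i j = n := by
  obtain ⟨p, hp⟩ := hG.exists_walk_length_eq_dist l i
  rw [SimpleGraph.dist_comm, h] at hp
  cases p with
  | nil => simp at hp
  | @cons _ j _ hadj q =>
    refine ⟨j, hadj, le_antisymm ?_ ?_⟩
    · rw [SimpleGraph.dist_comm]
      exact (SimpleGraph.dist_le q).trans (by simp at hp; omega)
    · have h1 : G.dist i l ≤ G.dist i j + G.dist j l := hG.dist_triangle
      rw [SimpleGraph.dist_eq_one_iff_adj.2 hadj.symm] at h1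
      omega

variable [Fintype V] [DecidableEq V]

/-- Both summands are positive semidefinite. If the form vanishes at `x`, the Laplacian makes `x`
constant along induced edges and `H` makes it zero at vertices sharing a neighbour with `i`, in
particular at distance `2`. Stepping along geodesics towards `i` then gives `x = 0` everywhere. -/
theorem posDef_Mkc {G : SimpleGraph V} [DecidableRel G.Adj] (hG : G.Connected) (k : ℕ) (i : V) :
    (Mkc G k i).PosDef := by
  have hL := (G.induce (khop G k i)).posSemidef_lapMatrix ℝ
  have hH : (Matrix.diagonal fun l : khop G k i =>
      ((G.neighborFinset l ∩ G.neighborFinset i).card : ℝ)).PosSemidef :=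
    Matrix.PosSemidef.diagonal fun l => Nat.cast_nonneg _
  refine Matrix.PosDef.of_dotProduct_mulVec_pos (hL.add hH).isHermitian fun x hx => ?_
  have hLx := hL.dotProduct_mulVec_nonneg x
  have hHx := hH.dotProduct_mulVec_nonneg x
  rw [Mkc, Matrix.add_mulVec, dotProduct_add]
  refine lt_of_le_of_ne (add_nonneg hLx hHx) fun h0 => hx ?_
  have hL0 : star x ⬝ᵥ ((G.induce (khop G k i)).lapMatrix ℝ *ᵥ x) = 0 := by linarith
  have hH0 : star x ⬝ᵥ ((Matrix.diagonal fun l : khop G k i =>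
      ((G.neighborFinset l ∩ G.neighborFinset i).card : ℝ)) *ᵥ x) = 0 := by linarith
  rw [star_trivial, ← Matrix.toLinearMap₂'_apply',
    SimpleGraph.lapMatrix_toLinearMap₂'_apply'_eq_zero_iff_forall_adj] at hL0
  simp only [star_trivial, dotProduct, Matrix.mulVec_diagonal] at hH0
  rw [Finset.sum_eq_zero_iff_of_nonneg (fun l _ => by
    have : (0 : ℝ) ≤ (G.neighborFinset l ∩ G.neighborFinset i).card := Nat.cast_nonneg _
    nlinarith [mul_nonneg this (mul_self_nonneg (x l))])] at hH0
  have key : ∀ n : ℕ, ∀ l : khop G k i, G.dist i l = n + 2 → x l = 0 := by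
    intro n
    induction n with
    | zero =>
      intro l hl
      obtain ⟨j, hadj, hj⟩ := exists_adj_dist_eq hG hl
      have hcard : ((G.neighborFinset l ∩ G.neighborFinset i).card : ℝ) ≠ 0 := by
        rw [Nat.cast_ne_zero, Finset.card_ne_zero]
        exact ⟨j, by simpa using ⟨hadj, SimpleGraph.dist_eq_one_iff_adj.1 hj⟩⟩
      simpa [hcard] using hH0 l (Finset.mem_univ _)
    | succ n ih =>
      intro l hl
      obtain ⟨j, hadj, hj⟩ := exists_adj_dist_eq hG hl
      -- The predecessor has distance `n + 2`, so it still lies in the `k`-hop set and the edge is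
      -- an induced one.
      have hjk : j ∈ khop G k i := ⟨by omega, by have := l.2.2; omega⟩
      rw [hL0 l ⟨j, hjk⟩ (by simpa using hadj)]
      exact ih ⟨j, hjk⟩ hj
  funext l
  exact key (G.dist i l - 2) l (by have := l.2.1; omega)

end Graph

/-! ### The disagreement vector as `(M ⊗ I)` applied to the error. -/

section Disagreement

variable {V : Type*} [Fintype V] [DecidableEq V]

theorem selection_mulVec {N : ℕ} (S : Set V) (x : V × Fin N → ℝ)
    (p : S × Fin N) : (selection N S *ᵥ x) p = x (p.1, p.2) := by
  simp [selection, Matrix.mulVec, dotProduct, Fintype.sum_prod_type, Matrix.one_apply]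

theorem selection_transpose_mulVec {N : ℕ} (S : Set V) [DecidablePred (· ∈ S)]
    (y : S × Fin N → ℝ) (p : V × Fin N) :
    ((selection N S)ᵀ *ᵥ y) p = if h : p.1 ∈ S then y (⟨p.1, h⟩, p.2) else 0 := by
  simp only [selection, Matrix.mulVec, dotProduct, Matrix.transpose_apply,
    Matrix.kroneckerMap_apply, Matrix.of_apply, Fintype.sum_prod_type, Matrix.one_apply, ite_mul,
    one_mul, zero_mul, mul_ite, mul_one, mul_zero, Finset.sum_ite_eq', Finset.mem_univ, if_true]
  split_ifs with h
  · rw [Finset.sum_eq_single ⟨p.1, h⟩] <;> aesop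
  · exact Finset.sum_eq_zero fun s _ => by aesop

omit [DecidableEq V] in
theorem sum_subtype_dite {M : Type*} [AddCommMonoid M] (S : Set V) [DecidablePred (· ∈ S)]
    (f : S → M) : ∑ s : S, f s = ∑ j : V, if h : j ∈ S then f ⟨j, h⟩ else 0 := by
  rw [← Finset.sum_subset (Finset.subset_univ (Finset.univ.filter (· ∈ S)))
    (fun j _ hj => by simp at hj; simp [hj]),
    Finset.sum_subtype (p := (· ∈ S)) _ (fun j => by simp)]
  exact Finset.sum_congr rfl fun s _ => by simp

variable {G : SimpleGraph V} [DecidableRel G.Adj] {k N : ℕ}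

/-- Both parts of `M` become sums over the neighbours of `l`, the index set of the sum in `rho`, so
that `rho_apply` can compare term by term. -/
theorem Mkc_mulVec_apply (i : V) (x : khop G k i → ℝ) (l : khop G k i) :
    (Mkc G k i *ᵥ x) l =
      ∑ j ∈ G.neighborFinset l, ((if h : j ∈ khop G k i then x l - x ⟨j, h⟩ else 0) +
        if G.Adj j i then x l else 0) := by
  have h1 : ((G.induce (khop G k i)).lapMatrix ℝ *ᵥ x) l =
      ∑ j : khop G k i, if G.Adj l j then x l - x j else 0 := by
    rw [SimpleGraph.lapMatrix_mulVec_apply, SimpleGraph.degree, Finset.cast_card, Finset.sum_mul,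
      ← Finset.sum_sub_distrib, SimpleGraph.neighborFinset_eq_filter, Finset.sum_filter]
    simp
  have h2 : ((G.neighborFinset l ∩ G.neighborFinset i).card : ℝ) * x l =
      ∑ j ∈ G.neighborFinset l, if G.Adj j i then x l else 0 := by
    rw [← Finset.sum_filter, Finset.sum_const, nsmul_eq_mul]
    congr 3
    ext j
    simp [G.adj_comm i j]
  rw [Mkc, Matrix.add_mulVec, Pi.add_apply, Matrix.mulVec_diagonal, h1, h2,
    Finset.sum_add_distrib, sum_subtype_dite]
  simp only [SimpleGraph.neighborFinset_eq_filter, Finset.sum_filter]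
  congr 1
  refine Finset.sum_congr rfl fun j _ => ?_
  split_ifs <;> rfl

/-- A neighbour `j` of `l` contributes the difference of the estimates of `u i` by `j` and `l`, that
is `e_l - e_j`, if `j` is a `k`-hop neighbour of `i` (a symmetric relation), and the error `e_l`
itself if `j` is adjacent to `i`. These are the Laplacian and the diagonal part of `M`. -/
theorem rho_apply (z : Estimates G k N) (w : V → EuclideanSpace ℝ (Fin N)) (i : V)
    (l : khop G k i) (a : Fin N) :
    rho G z w l (⟨i, khop_symm l.2⟩, a) =
      ((Mkc G k i ⊗ₖ (1 : Matrix (Fin N) (Fin N) ℝ)) *ᵥ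
        fun p => w i p.2 - z ⟨p.1, (⟨i, khop_symm p.1.2⟩, p.2)⟩) (l, a) := by
  rw [kronecker_one_mulVec, Mkc_mulVec_apply, rho, Finset.sum_apply]
  refine Finset.sum_congr rfl fun j _ => ?_
  have hil : i ∈ khop G k l := khop_symm l.2
  have hmem : i ∈ khop G k j ↔ j ∈ khop G k i := ⟨khop_symm, khop_symm⟩
  simp only [hatP, nbrP, Pi.add_apply, Pi.neg_apply, selection_mulVec, selection_transpose_mulVec,
    estimatesOf, stack, dif_pos hil, hmem, SimpleGraph.mem_neighborSet]
  split_ifs <;> ring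

theorem observerField_apply (gain : V → ℝ) (u : V → ℝ → EuclideanSpace ℝ (Fin N)) (t : ℝ)
    (z : Estimates G k N) (i : V) (p : khop G k i × Fin N) :
    observerField G k N gain u t z ⟨p.1, (⟨i, khop_symm p.1.2⟩, p.2)⟩ =
      gain i * sgn (((Mkc G k i ⊗ₖ (1 : Matrix (Fin N) (Fin N) ℝ)) *ᵥ
        fun p => u i t p.2 - z ⟨p.1, (⟨i, khop_symm p.1.2⟩, p.2)⟩) p) := by
  simp only [observerField, gainMatrix, kronecker_one_mulVec, Matrix.mulVec_diagonal]
  rw [rho_apply z (fun j => u j t) i p.1 p.2, kronecker_one_mulVec]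

/-- In the Filippov set of the observer, the gain sign is aligned with the disagreement. -/
theorem mul_eq_gain_mul_abs_of_mem_filippovMap (gain : V → ℝ)
    (u : V → ℝ → EuclideanSpace ℝ (Fin N)) (t : ℝ) (z v : Estimates G k N)
    (hv : v ∈ filippovMap (observerField G k N gain u t) z) (i : V) (p : khop G k i × Fin N) :
    ((Mkc G k i ⊗ₖ (1 : Matrix (Fin N) (Fin N) ℝ)) *ᵥ
        fun p => u i t p.2 - z ⟨p.1, (⟨i, khop_symm p.1.2⟩, p.2)⟩) p *
      v ⟨p.1, (⟨i, khop_symm p.1.2⟩, p.2)⟩ =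
    gain i * |((Mkc G k i ⊗ₖ (1 : Matrix (Fin N) (Fin N) ℝ)) *ᵥ
        fun p => u i t p.2 - z ⟨p.1, (⟨i, khop_symm p.1.2⟩, p.2)⟩) p| := by
  set c : Estimates G k N → ℝ := fun y => ((Mkc G k i ⊗ₖ (1 : Matrix (Fin N) (Fin N) ℝ)) *ᵥ
        fun p => u i t p.2 - y ⟨p.1, (⟨i, khop_symm p.1.2⟩, p.2)⟩) p with hc
  have hcont : Continuous c := by
    simp only [hc, Matrix.mulVec, dotProduct]
    fun_prop
  change c z * _ = gain i * |c z|
  let q : (l : V) × (khop G k l × Fin N) := ⟨p.1, (⟨i, khop_symm p.1.2⟩, p.2)⟩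
  change c z * v q = _
  have hF : ∀ y, observerField G k N gain u t y q = gain i * sgn (c y) :=
    fun y => observerField_apply gain u t y i p
  -- Where the sign of `c` is locally constant, nearby field values lie in one hyperplane, which is
  -- closed and convex and so contains the Filippov set.
  have hplane : ∀ r : ℝ, (∀ᶠ y in nhds z, sgn (c y) = r) → v q = gain i * r := by
    intro r hr
    have hlin : IsLinearMap ℝ fun y : Estimates G k N => y q := ⟨fun _ _ => rfl, fun _ _ => rfl⟩
    refine filippovMap_subset_of_eventually (C := {y | y q = gain i * r})
      (convex_hyperplane hlin _) (isClosed_eq (f := fun y : Estimates G k N => y q) (by fun_prop) continuous_const) ?_ hv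
    filter_upwards [hr] with y hy
    exact (hF y).trans (by rw [hy])
  rcases lt_trichotomy (c z) 0 with h | h | h
  · rw [hplane (-1) ((hcont.tendsto z).eventually_lt_const h |>.mono fun y hy => by
      simp [sgn, not_le.2 hy]), abs_of_neg h]
    ring
  -- On the switching surface both sides are zero, so neither `v` nor the convention for `sgn 0`
  -- matters.
  · simp [h]
  · rw [hplane 1 ((hcont.tendsto z).eventually_const_lt h |>.mono fun y hy => by
      simp [sgn, hy.le]), abs_of_pos h]
    ring

end Disagreement

/-! ### The input error as a difference of linear images. -/

section Error

variable {V : Type*} {G : SimpleGraph V} {k N : ℕ}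

/-- The vector with a copy of `w` for every index in `ι`. -/
noncomputable def replicateCLM (ι : Type*) [Fintype ι] (N : ℕ) :
    EuclideanSpace ℝ (Fin N) →L[ℝ] EuclideanSpace ℝ (ι × Fin N) :=
  LinearMap.toContinuousLinearMap
    { toFun := fun w => WithLp.toLp 2 fun p => w p.2
      map_add' := fun _ _ => rfl
      map_smul' := fun _ _ => rfl }

/-- The source of the factor `√η` in `psi`: the derivative of the input enters the error dynamics
once per `k`-hop neighbour. -/
theorem norm_replicateCLM (ι : Type*) [Fintype ι] (w : EuclideanSpace ℝ (Fin N)) :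
    ‖replicateCLM ι N w‖ = √(Fintype.card ι : ℝ) * ‖w‖ := by
  have h : ‖replicateCLM ι N w‖ ^ 2 = Fintype.card ι * ‖w‖ ^ 2 := by
    have happ : ∀ p, replicateCLM ι N w p = w p.2 := fun _ => rfl
    simp [EuclideanSpace.real_norm_sq_eq, happ, Fintype.sum_prod_type]
  rw [← Real.sqrt_sq (norm_nonneg (replicateCLM ι N w)), h, Real.sqrt_mul (Nat.cast_nonneg _),
    Real.sqrt_sq (norm_nonneg w)]

variable [Fintype V]

/-- The estimates of the input of agent `i` made by its `k`-hop neighbours. -/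
noncomputable def estimatesOnCLM (G : SimpleGraph V) (k N : ℕ) (i : V) :
    Estimates G k N →L[ℝ] EuclideanSpace ℝ (khop G k i × Fin N) :=
  LinearMap.toContinuousLinearMap
    { toFun := fun z => WithLp.toLp 2 fun p => z ⟨p.1, (⟨i, khop_symm p.1.2⟩, p.2)⟩
      map_add' := fun _ _ => rfl
      map_smul' := fun _ _ => rfl }

theorem inputError_eq (u : V → ℝ → EuclideanSpace ℝ (Fin N)) (z : ℝ → Estimates G k N) (i : V)
    (t : ℝ) : inputError u z i t =
      replicateCLM (khop G k i) N (u i t) - estimatesOnCLM G k N i (z t) :=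
  rfl

theorem locallyAC_inputError {u : V → ℝ → EuclideanSpace ℝ (Fin N)} {z : ℝ → Estimates G k N}
    {i : V} (hu : LocallyAC (u i)) (hz : LocallyAC z) : LocallyAC (inputError u z i) := by
  rw [funext (inputError_eq u z i)]
  exact (hu.clm_comp (replicateCLM (khop G k i) N)).sub (hz.clm_comp (estimatesOnCLM G k N i))

theorem norm_le_sum_abs {ι : Type*} [Fintype ι] (x : EuclideanSpace ℝ ι) : ‖x‖ ≤ ∑ p, |x p| := by
  rw [EuclideanSpace.norm_eq]
  refine Real.sqrt_le_iff.2 ⟨Finset.sum_nonneg fun _ _ => abs_nonneg _, ?_⟩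
  simpa using Finset.sum_sq_le_sq_sum_of_nonneg (s := Finset.univ) (f := fun p => |x p|)
    fun _ _ => abs_nonneg _

end Error

/-! ### Euclidean-norm bounds for `A ⊗ I`. -/

section LinearAlgebra

variable {n m : Type*} [Fintype n] [DecidableEq n] [Fintype m] [DecidableEq m] {A : Matrix n n ℝ}

theorem lambdaMin_mul_norm_sq_le_inner (hA : A.IsHermitian) (x : EuclideanSpace ℝ (n × m)) :
    lambdaMin A * ‖x‖ ^ 2 ≤
      inner ℝ x (Matrix.toEuclideanCLM (n := n × m) (𝕜 := ℝ) (A ⊗ₖ (1 : Matrix m m ℝ)) x) := by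
  rw [inner_toEuclideanCLM, ← dotProduct_self_eq_norm_sq]
  exact lambdaMin_mul_le_kronecker hA _

theorem inner_le_lambdaMax_mul_norm_sq (hA : A.IsHermitian) (x : EuclideanSpace ℝ (n × m)) :
    inner ℝ x (Matrix.toEuclideanCLM (n := n × m) (𝕜 := ℝ) (A ⊗ₖ (1 : Matrix m m ℝ)) x) ≤
      lambdaMax A * ‖x‖ ^ 2 := by
  rw [inner_toEuclideanCLM, ← dotProduct_self_eq_norm_sq]
  exact kronecker_le_lambdaMax_mul hA _

theorem lambdaMin_mul_norm_le (hA : A.IsHermitian) (x : EuclideanSpace ℝ (n × m)) :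
    lambdaMin A * ‖x‖ ≤
      ‖Matrix.toEuclideanCLM (n := n × m) (𝕜 := ℝ) (A ⊗ₖ (1 : Matrix m m ℝ)) x‖ := by
  rcases (norm_nonneg x).eq_or_lt with h | h
  · rw [← h, mul_zero]
    exact norm_nonneg _
  · refine le_of_mul_le_mul_left ?_ h
    calc ‖x‖ * (lambdaMin A * ‖x‖) = lambdaMin A * ‖x‖ ^ 2 := by ring
      _ ≤ _ := (lambdaMin_mul_norm_sq_le_inner hA x).trans (real_inner_le_norm _ _)

end LinearAlgebra

theorem hasDerivAt_norm_of_ne_zero {E : Type*} [NormedAddCommGroup E] [InnerProductSpace ℝ E]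
    {f : ℝ → E} {f' : E} {t : ℝ} (hf : HasDerivAt f f' t) (h : f t ≠ 0) :
    HasDerivAt (fun s => ‖f s‖) (inner ℝ (f t) f' / ‖f t‖) t := by
  have h2 := hf.norm_sq.sqrt (pow_ne_zero 2 (norm_ne_zero_iff.2 h))
  simp only [Real.sqrt_sq (norm_nonneg _)] at h2
  convert h2 using 1
  rw [mul_div_mul_left _ _ two_ne_zero]

/-! ### The Lyapunov estimate. -/

section Decay

variable {V : Type*} [Fintype V] [DecidableEq V] {G : SimpleGraph V} [DecidableRel G.Adj] {k N : ℕ}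
  {gain : V → ℝ} {u : V → ℝ → EuclideanSpace ℝ (Fin N)} {i : V}

/-- The disagreement of the errors on the input of agent `i`. -/
noncomputable abbrev disagreementCLM (G : SimpleGraph V) [DecidableRel G.Adj] (k N : ℕ) (i : V) :
    EuclideanSpace ℝ (khop G k i × Fin N) →L[ℝ] EuclideanSpace ℝ (khop G k i × Fin N) :=
  Matrix.toEuclideanCLM (n := khop G k i × Fin N) (𝕜 := ℝ)
    (Mkc G k i ⊗ₖ (1 : Matrix (Fin N) (Fin N) ℝ))

/-- By sign alignment the inner product is the gain times the `ℓ¹` norm of the disagreement, which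
dominates the Euclidean norm. -/
theorem gain_mul_norm_le_inner (hgain : 0 ≤ gain i) {z : ℝ → Estimates G k N} {t : ℝ}
    {v : Estimates G k N} (hv : v ∈ filippovMap (observerField G k N gain u t) (z t)) :
    gain i * ‖disagreementCLM G k N i (inputError u z i t)‖ ≤
      inner ℝ (disagreementCLM G k N i (inputError u z i t)) (estimatesOnCLM G k N i v) := by
  have hin : inner ℝ (disagreementCLM G k N i (inputError u z i t)) (estimatesOnCLM G k N i v) =
      gain i * ∑ p, |disagreementCLM G k N i (inputError u z i t) p| := by
    rw [PiLp.inner_apply, Finset.mul_sum]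
    refine Finset.sum_congr rfl fun p _ => ?_
    exact (mul_comm _ _).trans (mul_eq_gain_mul_abs_of_mem_filippovMap gain u t (z t) v hv i p)
  rw [hin]
  exact mul_le_mul_of_nonneg_left (norm_le_sum_abs _) hgain

/-- The quadratic form of the disagreement decreases along the error dynamics. -/
theorem inner_disagreement_le (hA : (Mkc G k i).PosDef) (hgain : 0 ≤ gain i)
    {z : ℝ → Estimates G k N} {t : ℝ} {v : Estimates G k N}
    (hv : v ∈ filippovMap (observerField G k N gain u t) (z t))
    {w : EuclideanSpace ℝ (Fin N)} {d : ℝ} (hw : ‖w‖ ≤ d) :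
    inner ℝ (disagreementCLM G k N i (inputError u z i t))
        (replicateCLM (khop G k i) N w - estimatesOnCLM G k N i v) ≤
      -(psi G k N gain i d * ‖inputError u z i t‖) := by
  have h1 := gain_mul_norm_le_inner hgain hv
  have h2 := mul_le_mul_of_nonneg_left
    (lambdaMin_mul_norm_le (m := Fin N) hA.isHermitian (inputError u z i t)) hgain
  have h3 : inner ℝ (disagreementCLM G k N i (inputError u z i t))
      (replicateCLM (khop G k i) N w) ≤
      specNorm (Mkc G k i ⊗ₖ (1 : Matrix (Fin N) (Fin N) ℝ)) * ‖inputError u z i t‖ *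
        (√(eta G k i : ℝ) * d) := by
    refine (real_inner_le_norm _ _).trans ?_
    rw [norm_replicateCLM]
    refine mul_le_mul (ContinuousLinearMap.le_opNorm _ _)
      (mul_le_mul_of_nonneg_left hw (Real.sqrt_nonneg _)) (by positivity)
      (mul_nonneg (norm_nonneg _) (norm_nonneg _))
  rw [inner_sub_right, psi]
  linarith

end Decay

end KHopObserver

/-! ### Finite-time convergence of the input error. -/

open KHopObserver in
theorem mainTheorem2 {V : Type*} [Fintype V] [DecidableEq V]
    (G : SimpleGraph V) [DecidableRel G.Adj] (hG : G.Connected) (k N : ℕ)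
    (gain : V → ℝ) (u : V → ℝ → EuclideanSpace ℝ (Fin N)) (z : ℝ → Estimates G k N)
    (hz : IsFilippovSolution (observerField G k N gain u) z)
    (i : V) (hi : (khop G k i).Nonempty)
    (hu : LocallyAC (u i)) (d : ℝ≥0) (hd : filippovNormOn (Ioi 0) (deriv (u i)) ≤ d)
    (hgain : lambdaMax (Mkc G k i) / lambdaMin (Mkc G k i) * √(eta G k i : ℝ) * d < gain i) :
    0 < lambdaMin (Mkc G k i) ∧ 0 < psi G k N gain i d ∧
      ∃ T : ℝ, IsLeast {s : ℝ | 0 ≤ s ∧ ∀ t, s ≤ t → inputError u z i t = 0} T ∧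
        (inputError u z i 0 ≠ 0 → 0 < T) ∧
        T ≤ lambdaMax (Mkc G k i) / psi G k N gain i d * ‖inputError u z i 0‖ := by
  have : Nonempty (khop G k i) := hi.to_subtype
  have hA : (Mkc G k i).PosDef := posDef_Mkc hG k i
  have hmin : 0 < lambdaMin (Mkc G k i) := lambdaMin_pos hA
  have hmax : 0 < lambdaMax (Mkc G k i) := hmin.trans_le (lambdaMin_le_lambdaMax hA.isHermitian)
  have hgain0 : 0 ≤ gain i := le_trans (by positivity) hgain.le
  -- Multiplying the gain condition by `λmin` gives `π λmin > λmax √η d`, and `‖M ⊗ I‖ ≤ λmax`.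
  have hpsi : 0 < psi G k N gain i d := by
    have h1 := mul_lt_mul_of_pos_right hgain hmin
    have h2 : lambdaMax (Mkc G k i) / lambdaMin (Mkc G k i) * √(eta G k i : ℝ) * d *
        lambdaMin (Mkc G k i) = lambdaMax (Mkc G k i) * (√(eta G k i : ℝ) * d) := by
      field_simp
    have h3 := mul_le_mul_of_nonneg_right (specNorm_kronecker_le (m := Fin N) hA)
      (show 0 ≤ √(eta G k i : ℝ) * d by positivity)
    rw [psi]
    linarith
  refine ⟨hmin, hpsi, ?_⟩
  obtain ⟨B, hB⟩ := exists_adjoint_comp_self (hA.posSemidef.kronecker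
    (Matrix.PosSemidef.one : (1 : Matrix (Fin N) (Fin N) ℝ).PosSemidef))
  have hBinner : ∀ x y, inner ℝ (B x) (B y) = inner ℝ (disagreementCLM G k N i x) y := fun x y => by
    rw [disagreementCLM, ← hB, ContinuousLinearMap.comp_apply,
      ContinuousLinearMap.adjoint_inner_left]
  have hBsq : ∀ x, ‖B x‖ ^ 2 = inner ℝ x (disagreementCLM G k N i x) := fun x => by
    rw [← real_inner_self_eq_norm_sq, hBinner, real_inner_comm]
  have hBle : ∀ x, ‖B x‖ ≤ √(lambdaMax (Mkc G k i)) * ‖x‖ := fun x => by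
    rw [← Real.sqrt_sq (norm_nonneg x), ← Real.sqrt_mul hmax.le]
    exact Real.le_sqrt_of_sq_le
      ((hBsq x).trans_le (inner_le_lambdaMax_mul_norm_sq hA.isHermitian x))
  have hB0 : ∀ x, ‖B x‖ = 0 → x = 0 := fun x hx => by
    have h1 := lambdaMin_mul_norm_sq_le_inner (m := Fin N) hA.isHermitian x
    rw [← hBsq, hx] at h1
    have h2 : ‖x‖ ^ 2 ≤ 0 := by nlinarith
    simpa using le_antisymm h2 (sq_nonneg _)
  set e := inputError u z i with he
  set W : ℝ → ℝ := fun t => ‖B (e t)‖ with hW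
  have hWac : LocallyAC W :=
    ((locallyAC_inputError hu hz.1).clm_comp B).lipschitz_comp lipschitzWith_one_norm
  have hWnn : ∀ t, 0 ≤ W t := fun t => norm_nonneg _
  have hsq : 0 < √(lambdaMax (Mkc G k i)) := Real.sqrt_pos.2 hmax
  -- The derivative of `W` is `⟨(M ⊗ I) e, e'⟩ / W ≤ -ψ ‖e‖ / W`, and `‖e‖ / W ≥ 1 / √λmax`.
  set c := psi G k N gain i d / √(lambdaMax (Mkc G k i)) with hc
  have hcpos : 0 < c := div_pos hpsi hsq
  have hdecay : ∀ᵐ t ∂(volume.restrict (Ioi (0 : ℝ))), 0 < W t → deriv W t ≤ -c := by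
    filter_upwards [hz.2, hu.ae_differentiableAt,
      ae_norm_le_of_filippovNormOn_le measurableSet_Ioi hd] with t ⟨v, hv, hzt⟩ hut hdt hWt
    have hder := hasDerivAt_norm_of_ne_zero (B.hasFDerivAt.comp_hasDerivAt t
      (((replicateCLM (khop G k i) N).hasFDerivAt.comp_hasDerivAt t hut.hasDerivAt).sub
        ((estimatesOnCLM G k N i).hasFDerivAt.comp_hasDerivAt t hzt))) (norm_pos_iff.1 hWt)
    have hderW : deriv W t = _ := hder.deriv
    rw [hderW]
    change inner ℝ (B (e t)) (B _) / W t ≤ -c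
    rw [div_le_iff₀ hWt, hBinner]
    refine (inner_disagreement_le hA hgain0 hv hdt).trans ?_
    rw [neg_mul, neg_le_neg_iff, hc, div_mul_eq_mul_div, div_le_iff₀ hsq, mul_assoc]
    exact mul_le_mul_of_nonneg_left ((hBle _).trans_eq (mul_comm _ _)) hpsi.le
  -- As `W` is antitone, it stays at zero once there. The admissible times are thus the zeros of a
  -- continuous function on `[0, ∞)`, a closed set, and a least one exists.
  have hset : {s : ℝ | 0 ≤ s ∧ ∀ t, s ≤ t → e t = 0} = Ici 0 ∩ W ⁻¹' {0} := by
    ext s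
    refine ⟨fun h => ⟨h.1, by simp [hW, h.2 s le_rfl]⟩, fun h => ⟨h.1, fun t hst => hB0 _ ?_⟩⟩
    have hs : W s = 0 := h.2
    exact le_antisymm (hs ▸ hWac.antitoneOn_of_ae_deriv_neg hWnn hcpos hdecay h.1
      (le_trans (mem_Ici.1 h.1) hst) hst) (hWnn t)
  have hmem : W 0 / c ∈ {s : ℝ | 0 ≤ s ∧ ∀ t, s ≤ t → e t = 0} :=
    ⟨div_nonneg (hWnn 0) hcpos.le, fun t ht =>
      hB0 _ (hWac.eq_zero_of_ae_deriv_neg hWnn hcpos hdecay ht)⟩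
  have hbdd : BddBelow {s : ℝ | 0 ≤ s ∧ ∀ t, s ≤ t → e t = 0} := ⟨0, fun s hs => hs.1⟩
  have hclosed : IsClosed {s : ℝ | 0 ≤ s ∧ ∀ t, s ≤ t → e t = 0} := by
    rw [hset]
    exact hWac.continuousOn.preimage_isClosed_of_isClosed isClosed_Ici isClosed_singleton
  have hleast := hclosed.isLeast_csInf ⟨_, hmem⟩ hbdd
  refine ⟨_, hleast, fun h0 => ?_, (hleast.2 hmem).trans ?_⟩
  · exact lt_of_le_of_ne hleast.1.1 fun h => h0 (hleast.1.2 0 h.symm.le)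
  -- One factor `√λmax` comes from `c`, the other from `W 0 ≤ √λmax ‖e 0‖`.
  · rw [hc, div_div_eq_mul_div, div_mul_eq_mul_div]
    refine div_le_div_of_nonneg_right ?_ hpsi.le
    calc W 0 * √(lambdaMax (Mkc G k i))
        ≤ √(lambdaMax (Mkc G k i)) * ‖e 0‖ * √(lambdaMax (Mkc G k i)) :=
          mul_le_mul_of_nonneg_right (hBle _) hsq.le
      _ = lambdaMax (Mkc G k i) * ‖e 0‖ := by
          rw [mul_right_comm, Real.mul_self_sqrt hmax.le]
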